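/- \textbf{Setting.} Alice and Bob run a protocol consisting of finitely many rounds. In round $i$ one of the parties applies an arbitrary quantum channel to his or her own system (this may add ancillas, measure, or discard subsystems), splits the result into a part that is kept and a $d_i$-dimensional quantum system, and sends the latter to the other party; after the last round each party applies a local channel. The communication cost of the protocol is $C=\sum_i\log_2 d_i$. (A classical message with $d$ possible values is a special case of a $d$-dimensional quantum message, so the cost counts communicated bits or qubits.) A protocol creates a state $|\theta\rangle$ from $k$ EPR pairs with fidelity at least $1-\epsilon$ if, run on the initial state $\bigl(\tfrac1{\sqrt2}(|00\rangle+|11\rangle)\bigr)^{\otimes k}$, it outputs a joint state $\widetilde\rho$ with $F(|\theta\rangle\langle\theta|,\widetilde\rho)\ge 1-\epsilon$, where $F(\sigma,\omega)=\bigl(\mathrm{Tr}\sqrt{\sigma^{1/2}\omega\,\sigma^{1/2}}\bigr)^2$. A bipartite pure state is separable if it is a product vector, and maximally entangled if all its non-zero Schmidt coefficients (the eigenvalues of Alice's reduced state) are equal. \textbf{Theorem.} There is $\epsilon_0>0$ such that for every bipartite pure state $|\psi\rangle$ of two finite-dimensional systems that is neither separable nor maximally entangled, and for every $0\le\epsilon<\epsilon_0$,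 there are a constant $D>0$ and a function $f:\mathbb N\to\mathbb R$ with $f(n)=o(\sqrt n)$ as $n\to\infty$, both depending only on $|\psi\rangle$ and $\epsilon$, such that for all $n,k\in\mathbb N$ every protocol that creates $|\psi\rangle^{\otimes n}$ from $k$ EPR pairs with fidelity at least $1-\epsilon$ has communication cost $$C\;\ge\; D\sqrt n-f(n).$$ -/

import Mathlib

open scoped Kronecker MatrixOrder

noncomputable section

/-! Bipartite pure states, in coordinates: systems `A` and `B` are finite index types (fixed
orthonormal bases), a vector of `ℂ^A ⊗ ℂ^B` is a function `A × B → ℂ`. -/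

/-- `ψ` is a unit vector. -/
def IsPureState {S : Type} [Fintype S] (ψ : S → ℂ) : Prop :=
  ∑ s, ‖ψ s‖ ^ 2 = 1

/-- The density matrix `|ψ⟩⟨ψ|`. -/
def pureDensity {S : Type} (ψ : S → ℂ) : Matrix S S ℂ :=
  Matrix.vecMulVec ψ (star ψ)

/-- `|ψ⟩^{⊗ n}`, where Alice holds all the `A` factors and Bob all the `B` factors. -/
def tensorPow {A B : Type} (ψ : A × B → ℂ) (n : ℕ) : (Fin n → A) × (Fin n → B) → ℂ :=
  fun p => ∏ i, ψ (p.1 i, p.2 i)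

/-- The EPR pair `(|00⟩ + |11⟩) / √2`. -/
def epr : Fin 2 × Fin 2 → ℂ :=
  fun p => if p.1 = p.2 then ((1 / √2 : ℝ) : ℂ) else 0

/-- A separable pure state: a product vector `|u⟩ ⊗ |v⟩`. -/
def IsSeparableState {A B : Type} (ψ : A × B → ℂ) : Prop :=
  ∃ (u : A → ℂ) (v : B → ℂ), ∀ a b, ψ (a, b) = u a * v b

/-- The coefficient matrix of `ψ`. -/
def coeffMatrix {A B : Type} (ψ : A × B → ℂ) : Matrix A B ℂ :=
  Matrix.of fun a b => ψ (a, b)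

/-- Alice's reduced state `Tr_B |ψ⟩⟨ψ|`, that is
`(a, a') ↦ ∑ b, ψ (a, b) * conj (ψ (a', b))`. -/
def reducedState {A B : Type} [Fintype B] (ψ : A × B → ℂ) : Matrix A A ℂ :=
  coeffMatrix ψ * (coeffMatrix ψ).conjTranspose

theorem reducedState_isHermitian {A B : Type} [Fintype B] (ψ : A × B → ℂ) :
    (reducedState ψ).IsHermitian :=
  Matrix.isHermitian_mul_conjTranspose_self _

/-- The Schmidt coefficients: the eigenvalues of Alice's reduced state (with multiplicity, padded
by zeros to the dimension of Alice's system). -/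
def schmidtCoeff {A B : Type} [Fintype A] [DecidableEq A] [Fintype B] (ψ : A × B → ℂ) : A → ℝ :=
  (reducedState_isHermitian ψ).eigenvalues

/-- Maximally entangled: all the non-zero Schmidt coefficients are equal. The Schmidt rank may be
smaller than the local dimensions, so this does not depend on the ambient spaces. -/
def IsMaximallyEntangled {A B : Type} [Fintype A] [DecidableEq A] [Fintype B]
    (ψ : A × B → ℂ) : Prop :=
  ∀ i j, schmidtCoeff ψ i ≠ 0 → schmidtCoeff ψ j ≠ 0 → schmidtCoeff ψ i = schmidtCoeff ψ j

/-- The Uhlmann fidelity `(Tr √(√σ ω √σ))²`. -/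
def fidelity {S : Type} [Fintype S] [DecidableEq S] (σ ω : Matrix S S ℂ) : ℝ :=
  (CFC.sqrt (CFC.sqrt σ * ω * CFC.sqrt σ)).trace.re ^ 2

/-! Local operations and two-party protocols. -/

/-- A quantum channel (completely positive trace preserving map) from system `A` to system `A'`,
by Kraus operators. It may add ancillas, measure, discard subsystems, and apply unitaries. -/
structure Channel (A A' : Type) [Fintype A] [DecidableEq A] [Fintype A'] where
  num : ℕ
  kraus : Fin num → Matrix A' A ℂ
  complete : ∑ k, (kraus k).conjTranspose * kraus k = 1

/-- Alice applies the channel `E` to her part of a bipartite system: `E ⊗ id`. -/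
def Channel.onLeft {A A' : Type} [Fintype A] [DecidableEq A] [Fintype A'] (E : Channel A A')
    {B : Type} [Fintype B] [DecidableEq B] (ρ : Matrix (A × B) (A × B) ℂ) :
    Matrix (A' × B) (A' × B) ℂ :=
  ∑ k, (E.kraus k ⊗ₖ (1 : Matrix B B ℂ)) * ρ * (E.kraus k ⊗ₖ (1 : Matrix B B ℂ)).conjTranspose

/-- Bob applies the channel `F` to his part of a bipartite system: `id ⊗ F`. -/
def Channel.onRight {B B' : Type} [Fintype B] [DecidableEq B] [Fintype B'] (F : Channel B B')
    {A : Type} [Fintype A] [DecidableEq A] (ρ : Matrix (A × B) (A × B) ℂ) :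
    Matrix (A × B') (A × B') ℂ :=
  ∑ k, ((1 : Matrix A A ℂ) ⊗ₖ F.kraus k) * ρ * ((1 : Matrix A A ℂ) ⊗ₖ F.kraus k).conjTranspose

/-- A protocol that starts with Alice holding `A` and Bob holding `B` and ends with Alice holding
`A'` and Bob holding `B'`. In each round one party applies a channel to their system, splits the
result into a system that is kept and a `d`-dimensional system, and sends the latter to the other
party. After the last round both apply a local channel. A classical message with `d` possible
values is a special case of a `d`-dimensional quantum message: the sender's channel measures,
keeps a copy of the outcome, and writes the outcome into the message system. -/
inductive Protocol (A' B' : Type) [Fintype A'] [Fintype B'] :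
    (A B : Type) → [Fintype A] → [DecidableEq A] → [Fintype B] → [DecidableEq B] → Type 1 where
  | finish {A B : Type} [Fintype A] [DecidableEq A] [Fintype B] [DecidableEq B]
      (E : Channel A A') (F : Channel B B') : Protocol A' B' A B
  | aliceSends {A B A₁ : Type} [Fintype A] [DecidableEq A] [Fintype B] [DecidableEq B]
      [Fintype A₁] [DecidableEq A₁] (d : ℕ) (E : Channel A (A₁ × Fin d))
      (rest : Protocol A' B' A₁ (Fin d × B)) : Protocol A' B' A B
  | bobSends {A B B₁ : Type} [Fintype A] [DecidableEq A] [Fintype B] [DecidableEq B]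
      [Fintype B₁] [DecidableEq B₁] (d : ℕ) (F : Channel B (Fin d × B₁))
      (rest : Protocol A' B' (A × Fin d) B₁) : Protocol A' B' A B

/-- The final joint state of a protocol that is run on the joint state `ρ`. -/
def Protocol.run {A' B' : Type} [Fintype A'] [DecidableEq A'] [Fintype B'] [DecidableEq B']
    {A B : Type} [iA : Fintype A] [dA : DecidableEq A] [iB : Fintype B] [dB : DecidableEq B]
    (P : Protocol A' B' A B) (ρ : Matrix (A × B) (A × B) ℂ) : Matrix (A' × B') (A' × B') ℂ :=
  match A, B, iA, dA, iB, dB, P, ρ with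
  | _, _, _, _, _, _, @Protocol.finish _ _ _ _ _ _ _ _ _ _ E F, ρ => F.onRight (E.onLeft ρ)
  | _, B, _, _, _, _, @Protocol.aliceSends _ _ _ _ _ _ A₁ _ _ _ _ _ _ d E rest, ρ =>
      rest.run ((E.onLeft ρ).submatrix (Equiv.prodAssoc A₁ (Fin d) B).symm
        (Equiv.prodAssoc A₁ (Fin d) B).symm)
  | A, _, _, _, _, _, @Protocol.bobSends _ _ _ _ _ _ B₁ _ _ _ _ _ _ d F rest, ρ =>
      rest.run ((F.onRight ρ).submatrix (Equiv.prodAssoc A (Fin d) B₁)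
        (Equiv.prodAssoc A (Fin d) B₁))

/-- The total communication, in both directions: the sum of `log₂ d` over all messages. -/
def Protocol.cost {A' B' : Type} [Fintype A'] [Fintype B']
    {A B : Type} [iA : Fintype A] [dA : DecidableEq A] [iB : Fintype B] [dB : DecidableEq B]
    (P : Protocol A' B' A B) : ℝ :=
  match A, B, iA, dA, iB, dB, P with
  | _, _, _, _, _, _, @Protocol.finish _ _ _ _ _ _ _ _ _ _ _ _ => 0
  | _, _, _, _, _, _, @Protocol.aliceSends _ _ _ _ _ _ _ _ _ _ _ _ _ d _ rest =>
      Real.logb 2 d + rest.cost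
  | _, _, _, _, _, _, @Protocol.bobSends _ _ _ _ _ _ _ _ _ _ _ _ _ d _ rest =>
      Real.logb 2 d + rest.cost

end

/-! The proof follows the global pure state of a protocol through its coefficient matrix `Z`, with
Alice's systems as rows and Bob's as columns, after every channel has been replaced by its
Stinespring isometry. Local isometries change neither the operator norm nor the trace norm of `Z`.
Sending a `d`-dimensional system moves an index from the rows to the columns or back, which
multiplies each of these norms by at most `√d` (`norm_moveRight_le`, `norm_moveLeft_le`; the trace
norm is handled by duality). For `k` EPR pairs, `Z` is a multiple of the identity, with operator
norm `2 ^ (-k/2)` and trace norm `2 ^ (k/2)`. So at the end of a protocol of cost `C` the product of the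
two norms is at most `2 ^ C`, whatever `k` is (`HasPurification.run`).

High fidelity with `θ = ψ ^ ⊗ n` means that the final global state `W` is close to `θ ⊗ ξ` for some
junk state `ξ`. Let `p` and `q` be the Schmidt coefficients of `θ` and `ξ`. Where `p ≥ b`, the
operator norm of `W` limits its overlap with the part of `θ ⊗ ξ` on large `q`; where `p ≤ a`, the
trace norm limits its overlap with the part on small `q`. If both ranges of `p` carry a constant
mass, `ξ` can satisfy both constraints only if the product of the norms is at least of order
`√(b / a)` (`spread_bound`). This is where it matters that the junk `ξ` is common to all components
of `θ`.

The Schmidt coefficients of `ψ ^ ⊗ n` are products of `n` coefficients of `ψ`, so their logarithms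
are a sum of `n` independent variables, of positive variance because `ψ` is not maximally entangled.
Second and fourth moments show that this sum deviates by order `√n` to either side of its mean with
probability at least `1/20` (`upper_deviation`). Hence `b / a` can be taken exponentially large in
`√n` (`exists_spread`), and `C` is at least of order `√n`. -/

/-! ### Operator norm and trace norm of matrices -/

section OperatorNorm

open Matrix
open scoped Matrix.Norms.L2Operator

variable {l m n : Type*} [Fintype l] [Fintype m] [Fintype n]

theorem l2_opNorm_one_le [DecidableEq n] : ‖(1 : Matrix n n ℂ)‖ ≤ 1 := by
  rw [← diagonal_one, l2_opNorm_diagonal]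
  exact (pi_norm_le_iff_of_nonneg zero_le_one).2 fun _ => by simp

theorem l2_opNorm_le_one_of_isometry [DecidableEq n] {V : Matrix m n ℂ}
    (hV : Vᴴ * V = 1) : ‖V‖ ≤ 1 := by
  have h := l2_opNorm_conjTranspose_mul_self V
  rw [hV] at h
  have h1 := l2_opNorm_one_le (n := n)
  nlinarith [norm_nonneg V]

theorem l2_opNorm_le_one_of_coisometry [DecidableEq m] [DecidableEq n] {V : Matrix m n ℂ}
    (hV : V * Vᴴ = 1) : ‖V‖ ≤ 1 := by
  rw [← l2_opNorm_conjTranspose]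
  exact l2_opNorm_le_one_of_isometry (by rwa [conjTranspose_conjTranspose])

theorem l2_opNorm_mul_conjTranspose_self [DecidableEq m] [DecidableEq n]
    (A : Matrix m n ℂ) : ‖A * Aᴴ‖ = ‖A‖ ^ 2 := by
  have h := l2_opNorm_conjTranspose_mul_self Aᴴ
  rw [conjTranspose_conjTranspose, l2_opNorm_conjTranspose] at h
  rw [h, sq]

/-- Left multiplication by a contraction does not increase the operator norm. -/
theorem l2_opNorm_mul_le_right [DecidableEq m] [DecidableEq n] {V : Matrix l m ℂ} (hV : ‖V‖ ≤ 1)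
    (Z : Matrix m n ℂ) :
    ‖V * Z‖ ≤ ‖Z‖ :=
  (l2_opNorm_mul V Z).trans (mul_le_of_le_one_left (norm_nonneg _) hV)

/-- Right multiplication by a contraction does not increase the operator norm. -/
theorem l2_opNorm_mul_le_left [DecidableEq n] [DecidableEq l] {V : Matrix n l ℂ} (hV : ‖V‖ ≤ 1)
    (Z : Matrix m n ℂ) :
    ‖Z * V‖ ≤ ‖Z‖ :=
  (l2_opNorm_mul Z V).trans (mul_le_of_le_one_right (norm_nonneg _) hV)

theorem l2_opNorm_submatrix_rows_le [DecidableEq l] [DecidableEq m] [DecidableEq n]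
    (Z : Matrix m n ℂ) {f : l → m} (hf : f.Injective) :
    ‖Z.submatrix f id‖ ≤ ‖Z‖ := by
  have h : Z.submatrix f id = (1 : Matrix m m ℂ).submatrix f id * Z := by
    ext i j
    simp [mul_apply, one_apply]
  rw [h]
  refine l2_opNorm_mul_le_right (l2_opNorm_le_one_of_coisometry ?_) Z
  ext i j
  simp [mul_apply, one_apply, hf.eq_iff, eq_comm]

theorem l2_opNorm_submatrix_cols_le [DecidableEq l] [DecidableEq m] [DecidableEq n]
    (Z : Matrix m n ℂ) {f : l → n} (hf : f.Injective) :
    ‖Z.submatrix id f‖ ≤ ‖Z‖ := by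
  have h := l2_opNorm_submatrix_rows_le Zᴴ hf
  rw [← conjTranspose_submatrix, l2_opNorm_conjTranspose, l2_opNorm_conjTranspose] at h
  exact h

theorem norm_row_mul_le [DecidableEq n] (Z : Matrix m n ℂ) (i : m) (v : n → ℂ) :
    ‖∑ j, Z i j * v j‖ ≤ ‖Z‖ * √(∑ j, ‖v j‖ ^ 2) := by
  have h := l2_opNorm_mulVec Z (WithLp.toLp 2 v)
  rw [EuclideanSpace.norm_eq (WithLp.toLp 2 v)] at h
  refine le_trans ?_ h
  have := PiLp.norm_apply_le ((EuclideanSpace.equiv m ℂ).symm (Z *ᵥ v)) i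
  simpa [mulVec, dotProduct] using this

theorem norm_apply_le_l2_opNorm [DecidableEq n] (Z : Matrix m n ℂ) (i : m)
    (j : n) : ‖Z i j‖ ≤ ‖Z‖ := by
  have h := norm_row_mul_le Z i (Pi.single j 1)
  have h2 : ∑ x, ‖(Pi.single j (1 : ℂ) : n → ℂ) x‖ ^ 2 = 1 := by
    rw [Finset.sum_eq_single j] <;> simp +contextual
  rw [h2] at h
  simpa [Pi.single_apply] using h

/-- The trace norm of `Z` is at most `γ`, expressed through duality with the operator norm. -/
def TraceNormLE [DecidableEq n] (γ : ℝ) (Z : Matrix m n ℂ) : Prop :=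
  ∀ T : Matrix m n ℂ, ‖(Z * Tᴴ).trace‖ ≤ γ * ‖T‖

theorem TraceNormLE.mul_left [DecidableEq l] [DecidableEq m] [DecidableEq n] {γ : ℝ} (hγ : 0 ≤ γ)
    {Z : Matrix m n ℂ} (hZ : TraceNormLE γ Z)
    {V : Matrix l m ℂ} (hV : ‖V‖ ≤ 1) : TraceNormLE γ (V * Z) := fun T => by
  have h := hZ (Vᴴ * T)
  rw [conjTranspose_mul, conjTranspose_conjTranspose, ← Matrix.mul_assoc, trace_mul_comm,
    ← Matrix.mul_assoc] at h
  exact h.trans (mul_le_mul_of_nonneg_left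
    (l2_opNorm_mul_le_right (by rwa [l2_opNorm_conjTranspose]) T) hγ)

theorem TraceNormLE.mul_right [DecidableEq l] [DecidableEq m] [DecidableEq n] {γ : ℝ}
    (hγ : 0 ≤ γ) {Z : Matrix m n ℂ} (hZ : TraceNormLE γ Z)
    {V : Matrix n l ℂ} (hV : ‖V‖ ≤ 1) : TraceNormLE γ (Z * V) := fun T => by
  have h := hZ (T * Vᴴ)
  rw [conjTranspose_mul, conjTranspose_conjTranspose, ← Matrix.mul_assoc] at h
  exact h.trans (mul_le_mul_of_nonneg_left
    (l2_opNorm_mul_le_left (by rwa [l2_opNorm_conjTranspose]) T) hγ)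

end OperatorNorm

/-! ### Moving a system between the parties -/

section Messages

open Matrix
open scoped Matrix.Norms.L2Operator

variable {J A D J' B : Type*} [Fintype J] [Fintype A] [Fintype D] [Fintype J'] [Fintype B]

/-- Handing the system `D` from Alice (rows) to Bob (columns), on coefficient matrices. -/
def moveRight (Z : Matrix (J × (A × D)) (J' × B) ℂ) : Matrix (J × A) (J' × (D × B)) ℂ :=
  Matrix.of fun p q => Z (p.1, (p.2, q.2.1)) (q.1, q.2.2)

/-- Handing the system `D` from Bob (columns) to Alice (rows), on coefficient matrices. -/
def moveLeft (Z : Matrix (J × A) (J' × (D × B)) ℂ) : Matrix (J × (A × D)) (J' × B) ℂ :=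
  Matrix.of fun p q => Z (p.1, p.2.1) (q.1, (p.2.2, q.2))

/-- Cutting a matrix into `|D|` blocks, each of norm at most `‖Z‖`, and stacking them in the other
direction costs at most a factor `√|D|`. -/
theorem norm_moveRight_le [DecidableEq J] [DecidableEq A] [DecidableEq D] [DecidableEq J']
    [DecidableEq B] (Z : Matrix (J × (A × D)) (J' × B) ℂ) :
    ‖moveRight Z‖ ≤ √(Fintype.card D) * ‖Z‖ := by
  have h : moveRight Z * (moveRight Z)ᴴ =
      ∑ m : D, Z.submatrix (fun p : J × A => (p.1, (p.2, m))) id *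
        (Z.submatrix (fun p : J × A => (p.1, (p.2, m))) id)ᴴ := by
    ext p q
    simp only [mul_apply, Matrix.sum_apply, conjTranspose_apply, submatrix_apply, id, moveRight,
      of_apply,
      Fintype.sum_prod_type]
    exact Finset.sum_comm
  have h2 : ‖moveRight Z‖ ^ 2 ≤ Fintype.card D * ‖Z‖ ^ 2 := by
    rw [← l2_opNorm_mul_conjTranspose_self, h]
    refine (norm_sum_le _ _).trans ?_
    rw [← nsmul_eq_mul, ← Finset.card_univ, ← Finset.sum_const]
    refine Finset.sum_le_sum fun m _ => ?_
    rw [l2_opNorm_mul_conjTranspose_self]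
    refine pow_le_pow_left₀ (norm_nonneg _) (l2_opNorm_submatrix_rows_le Z ?_) 2
    rintro ⟨x, a⟩ ⟨x', a'⟩ h
    simpa using h
  refine (pow_le_pow_iff_left₀ (norm_nonneg _) (by positivity) two_ne_zero).1 ?_
  rwa [mul_pow, Real.sq_sqrt (Nat.cast_nonneg _)]

theorem norm_moveLeft_le [DecidableEq J] [DecidableEq A] [DecidableEq D] [DecidableEq J']
    [DecidableEq B] (Z : Matrix (J × A) (J' × (D × B)) ℂ) :
    ‖moveLeft Z‖ ≤ √(Fintype.card D) * ‖Z‖ := by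
  have h : (moveLeft Z)ᴴ * moveLeft Z =
      ∑ m : D, (Z.submatrix id (fun p : J' × B => (p.1, (m, p.2))))ᴴ *
        Z.submatrix id (fun p : J' × B => (p.1, (m, p.2))) := by
    ext p q
    simp only [mul_apply, Matrix.sum_apply, conjTranspose_apply, submatrix_apply, id, moveLeft,
      of_apply,
      Fintype.sum_prod_type]
    simp_rw [Finset.sum_comm (s := (Finset.univ : Finset D))]
  have h2 : ‖moveLeft Z‖ ^ 2 ≤ Fintype.card D * ‖Z‖ ^ 2 := by
    rw [sq, ← l2_opNorm_conjTranspose_mul_self, h]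
    refine (norm_sum_le _ _).trans ?_
    rw [← nsmul_eq_mul, ← Finset.card_univ, ← Finset.sum_const]
    refine Finset.sum_le_sum fun m _ => ?_
    rw [l2_opNorm_conjTranspose_mul_self, ← sq]
    refine pow_le_pow_left₀ (norm_nonneg _) (l2_opNorm_submatrix_cols_le Z ?_) 2
    rintro ⟨x, a⟩ ⟨x', a'⟩ h
    simpa using h
  refine (pow_le_pow_iff_left₀ (norm_nonneg _) (by positivity) two_ne_zero).1 ?_
  rwa [mul_pow, Real.sq_sqrt (Nat.cast_nonneg _)]

theorem trace_moveRight_mul (Z T : Matrix (J × (A × D)) (J' × B) ℂ) :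
    (moveRight Z * (moveRight T)ᴴ).trace = (Z * Tᴴ).trace := by
  simp only [trace, diag_apply, mul_apply, conjTranspose_apply, moveRight, of_apply,
    Fintype.sum_prod_type]
  refine Finset.sum_congr rfl fun x _ => Finset.sum_congr rfl fun a _ => Finset.sum_comm

theorem TraceNormLE.moveRight [DecidableEq J] [DecidableEq A] [DecidableEq D] [DecidableEq J']
    [DecidableEq B] {γ : ℝ} (hγ : 0 ≤ γ) {Z : Matrix (J × (A × D)) (J' × B) ℂ}
    (hZ : TraceNormLE γ Z) : TraceNormLE (√(Fintype.card D) * γ) (moveRight Z) := fun T => by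
  have h := (hZ (_root_.moveLeft T)).trans (mul_le_mul_of_nonneg_left (norm_moveLeft_le T) hγ)
  rw [← trace_moveRight_mul] at h
  rw [mul_comm (√_) γ, mul_assoc]
  exact h

theorem TraceNormLE.moveLeft [DecidableEq J] [DecidableEq A] [DecidableEq D] [DecidableEq J']
    [DecidableEq B] {γ : ℝ} (hγ : 0 ≤ γ) {Z : Matrix (J × A) (J' × (D × B)) ℂ}
    (hZ : TraceNormLE γ Z) : TraceNormLE (√(Fintype.card D) * γ) (moveLeft Z) := fun T => by
  rw [← trace_moveRight_mul]
  refine (hZ _).trans ((mul_le_mul_of_nonneg_left (norm_moveRight_le T) hγ).trans (le_of_eq ?_))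
  ring

end Messages

/-! ### Moments and deviations of sums of independent variables -/

section Moments

variable {A : Type*} [Fintype A]

theorem sum_prod_mul_succ (p : A → ℝ) (n : ℕ) (F : (Fin (n + 1) → A) → ℝ) :
    ∑ I : Fin (n + 1) → A, (∏ l, p (I l)) * F I =
      ∑ a, p a * ∑ I : Fin n → A, (∏ l, p (I l)) * F (Fin.cons a I) := by
  rw [← (Fin.consEquiv fun _ => A).sum_comp, Fintype.sum_prod_type]
  refine Finset.sum_congr rfl fun a _ => ?_
  rw [Finset.mul_sum]
  refine Finset.sum_congr rfl fun I _ => ?_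
  simp [Fin.consEquiv, Fin.prod_univ_succ, mul_assoc]

theorem sum_prod_eq_one {p : A → ℝ} (hp : ∑ a, p a = 1) (n : ℕ) :
    ∑ I : Fin n → A, ∏ l, p (I l) = 1 := by
  have h := Finset.prod_univ_sum (fun _ : Fin n => (Finset.univ : Finset A)) (fun _ => p)
  simpa [hp] using h.symm

/-- The first, second and fourth moments of a sum of `n` independent copies of a centred random
variable `x` with law `p`. -/
theorem iid_moments {p x : A → ℝ} (hp : ∑ a, p a = 1) (hx : ∑ a, p a * x a = 0) (n : ℕ) :
    ∑ I : Fin n → A, (∏ l, p (I l)) * (∑ l, x (I l)) = 0 ∧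
    ∑ I : Fin n → A, (∏ l, p (I l)) * (∑ l, x (I l)) ^ 2 = n * ∑ a, p a * x a ^ 2 ∧
    ∑ I : Fin n → A, (∏ l, p (I l)) * (∑ l, x (I l)) ^ 4 =
      n * (∑ a, p a * x a ^ 4) + 3 * n * (n - 1) * (∑ a, p a * x a ^ 2) ^ 2 := by
  induction n with
  | zero => simp
  | succ n ih =>
    obtain ⟨h1, h2, h4⟩ := ih
    have h0 := sum_prod_eq_one hp n
    refine ⟨?_, ?_, ?_⟩
    · rw [sum_prod_mul_succ]
      simp only [Fin.sum_univ_succ, Fin.cons_zero, Fin.cons_succ, mul_add, Finset.sum_add_distrib,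
        ← Finset.sum_mul, h0, h1]
      simp [hx]
    · rw [sum_prod_mul_succ]
      have (a : A) (I : Fin n → A) : (∏ l, p (I l)) * (x a + ∑ l, x (I l)) ^ 2 =
          (∏ l, p (I l)) * x a ^ 2 + (∏ l, p (I l)) * (∑ l, x (I l)) * (2 * x a)
            + (∏ l, p (I l)) * (∑ l, x (I l)) ^ 2 := by ring
      simp only [Fin.sum_univ_succ, Fin.cons_zero, Fin.cons_succ, this, Finset.sum_add_distrib,
        ← Finset.sum_mul, h0, h1, h2, mul_add, hp]
      push_cast
      simp only [zero_mul, mul_zero, Finset.sum_const_zero]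
      ring_nf
    · rw [sum_prod_mul_succ]
      have (a : A) (I : Fin n → A) : (∏ l, p (I l)) * (x a + ∑ l, x (I l)) ^ 4 =
          (∏ l, p (I l)) * x a ^ 4 + (∏ l, p (I l)) * (∑ l, x (I l)) * (4 * x a ^ 3)
            + (∏ l, p (I l)) * (∑ l, x (I l)) ^ 2 * (6 * x a ^ 2)
            + (∏ l, p (I l)) * (∑ l, x (I l)) ^ 3 * (4 * x a)
            + (∏ l, p (I l)) * (∑ l, x (I l)) ^ 4 := by ring
      simp only [Fin.sum_univ_succ, Fin.cons_zero, Fin.cons_succ, this, Finset.sum_add_distrib,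
        ← Finset.sum_mul, h0, h1, h2, h4, mul_add, hp]
      have e1 (c : ℝ) : ∑ a, p a * (c * (4 * x a)) = 0 := by
        have : ∀ a, p a * (c * (4 * x a)) = 4 * c * (p a * x a) := fun a => by ring
        simp only [this, ← Finset.mul_sum, hx, mul_zero]
      have e2 (c : ℝ) : ∑ a, p a * (c * (6 * x a ^ 2)) = 6 * c * ∑ a, p a * x a ^ 2 := by
        rw [Finset.mul_sum]
        exact Finset.sum_congr rfl fun a _ => by ring
      simp only [e1, e2]
      push_cast
      simp only [one_mul, zero_mul, mul_zero, Finset.sum_const_zero]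
      ring

/-- A centred random variable `X` with variance `s²` and fourth moment at most `4 s⁴` exceeds `s/8`
with probability at least `1/20`. -/
theorem upper_deviation {Ω : Type*} [Fintype Ω] {P X : Ω → ℝ} (hP : ∀ I, 0 ≤ P I)
    (hP1 : ∑ I, P I = 1) {s : ℝ} (hs : 0 < s) (h1 : ∑ I, P I * X I = 0)
    (h2 : ∑ I, P I * X I ^ 2 = s ^ 2) (h4 : ∑ I, P I * X I ^ 4 ≤ 4 * s ^ 4) :
    1 / 20 ≤ ∑ I with s / 8 ≤ X I, P I := by
  -- With `v = X / (2 s)`, the quartic `2 v + 3 v² - v⁴ - 1/4` is at most `5`, is nonpositive for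
  -- `v < 1/16`, and has expectation at least `1/4`.
  have key (I : Ω) : P I * X I / s + 3 / 4 * (P I * X I ^ 2) / s ^ 2 - (P I * X I ^ 4) /
    (16 * s ^ 4)
      - P I / 4 ≤ 5 * (if s / 8 ≤ X I then P I else 0) := by
    obtain ⟨v, hv⟩ : ∃ v, X I = 2 * s * v := ⟨X I / (2 * s), by field_simp⟩
    have e : P I * X I / s + 3 / 4 * (P I * X I ^ 2) / s ^ 2 - (P I * X I ^ 4) / (16 * s ^ 4)
      - P I / 4 = P I * (2 * v + 3 * v ^ 2 - v ^ 4 - 1 / 4) := by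
      rw [hv]; field_simp; ring
    rw [e]
    split_ifs with h
    · have : 2 * v + 3 * v ^ 2 - v ^ 4 - 1 / 4 ≤ 5 := by
        nlinarith [sq_nonneg (v ^ 2 - 15 / 8), sq_nonneg (v - 4 / 3)]
      nlinarith [hP I]
    · have hv' : v < 1 / 16 := by
        rw [hv] at h
        by_contra hc
        exact h (by nlinarith)
      have : 2 * v + 3 * v ^ 2 - v ^ 4 - 1 / 4 ≤ 0 := by
        rcases le_total v 0 with hv0 | hv0
        · nlinarith [mul_nonneg (neg_nonneg.2 hv0) (sq_nonneg (v + 1)),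
            mul_nonneg (sq_nonneg v) (sq_nonneg (v + 1))]
        · nlinarith [sq_nonneg v, mul_nonneg hv0 hv0, sq_nonneg (v ^ 2)]
      nlinarith [hP I]
  have hsum := Finset.sum_le_sum fun I (_ : I ∈ Finset.univ) => key I
  rw [← Finset.mul_sum, ← Finset.sum_filter, Finset.sum_sub_distrib, Finset.sum_sub_distrib,
    Finset.sum_add_distrib, ← Finset.sum_div, ← Finset.sum_div, ← Finset.sum_div, ← Finset.sum_div,
    ← Finset.mul_sum, h1, h2, hP1] at hsum
  have hq : (∑ I, P I * X I ^ 4) / (16 * s ^ 4) ≤ 1 / 4 := by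
    rw [div_le_iff₀ (by positivity)]
    linarith
  have hr : 3 / 4 * s ^ 2 / s ^ 2 = 3 / 4 := by field_simp
  rw [hr] at hsum
  norm_num at hsum hq ⊢
  linarith

end Moments

/-! ### Purified runs of protocols -/

section Purification

open Matrix
open scoped Matrix.Norms.L2Operator

/-- The unnormalized state of `A × B` that is left when the environments `J` of Alice and `J'` of
Bob are found in the basis states `x` and `y`; `Z` is the coefficient matrix of the global vector,
rows for Alice and columns for Bob. -/
def branch {J A J' B : Type} (Z : Matrix (J × A) (J' × B) ℂ) (x : J) (y : J') : A × B → ℂ :=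
  fun s => Z (x, s.1) (y, s.2)

/-- `ρ` has a purification, with one environment for each party, whose coefficient matrix has
operator norm at most `β`, trace norm at most `γ` and Frobenius norm `1`. -/
def HasPurification {A B : Type} [Fintype A] [DecidableEq A] [Fintype B] [DecidableEq B]
    (β γ : ℝ) (ρ : Matrix (A × B) (A × B) ℂ) : Prop :=
  ∃ (J J' : Type) (_ : Fintype J) (_ : DecidableEq J) (_ : Fintype J') (_ : DecidableEq J')
    (Z : Matrix (J × A) (J' × B) ℂ), ρ = ∑ x, ∑ y, pureDensity (branch Z x y) ∧
      ‖Z‖ ≤ β ∧ TraceNormLE γ Z ∧ (Z * Zᴴ).trace = 1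

theorem mul_pureDensity_mul {S T : Type} [Fintype S] (M : Matrix T S ℂ) (v : S → ℂ) :
    M * pureDensity v * Mᴴ = pureDensity (M *ᵥ v) := by
  rw [pureDensity, pureDensity, mul_vecMulVec, vecMulVec_mul, star_mulVec]

/-- The Stinespring isometry of a channel, acting trivially on an environment `J`; the index of the
Kraus operator is added to the environment. -/
def Channel.isometry {A A' : Type} [Fintype A] [DecidableEq A] [Fintype A'] (E : Channel A A')
    (J : Type) [DecidableEq J] : Matrix ((Fin E.num × J) × A') (J × A) ℂ :=
  Matrix.of fun p q => if p.1.2 = q.1 then E.kraus p.1.1 p.2 q.2 else 0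

theorem Channel.conjTranspose_isometry_mul_self {A A' : Type} [Fintype A] [DecidableEq A]
    [Fintype A'] (E : Channel A A') (J : Type) [Fintype J] [DecidableEq J] :
    (E.isometry J)ᴴ * E.isometry J = 1 := by
  ext ⟨x, a⟩ ⟨x', a'⟩
  have h := congrFun (congrFun E.complete a) a'
  simp only [Matrix.sum_apply, mul_apply, conjTranspose_apply] at h
  by_cases hx : x = x'
  · subst hx
    simp only [mul_apply, conjTranspose_apply, Channel.isometry, of_apply, Fintype.sum_prod_type,
      one_apply, Prod.mk.injEq, true_and]
    rw [one_apply] at h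
    rw [← h]
    refine Finset.sum_congr rfl fun k _ => ?_
    rw [Finset.sum_eq_single x]
    · simp
    · intro z _ hz
      simp [hz]
    · simp
  · simp only [mul_apply, conjTranspose_apply, Channel.isometry, of_apply, Fintype.sum_prod_type,
      one_apply, Prod.mk.injEq, hx, false_and, if_false]
    refine Finset.sum_eq_zero fun k _ => Finset.sum_eq_zero fun z _ => Finset.sum_eq_zero
      fun b _ => ?_
    by_cases hz : z = x
    · subst hz; simp [hx]
    · simp [hz]

theorem Protocol.cost_nonneg {A B A' B' : Type} [Fintype A] [DecidableEq A] [Fintype B]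
    [DecidableEq B] [Fintype A'] [Fintype B'] (P : Protocol A' B' A B) : 0 ≤ P.cost := by
  have h (d : ℕ) : 0 ≤ Real.logb 2 d := by
    rcases Nat.eq_zero_or_pos d with rfl | hd
    · simp
    · exact Real.logb_nonneg one_lt_two (by exact_mod_cast hd)
  induction P with
  | finish E F => exact le_of_eq (by rw [Protocol.cost])
  | aliceSends d E rest ih => rw [Protocol.cost]; exact add_nonneg (h d) ih
  | bobSends d F rest ih => rw [Protocol.cost]; exact add_nonneg (h d) ih

variable {A B A' B' : Type} [Fintype A] [DecidableEq A] [Fintype B] [DecidableEq B]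
  [Fintype A'] [DecidableEq A'] [Fintype B'] [DecidableEq B']

theorem HasPurification.mono {β γ β' γ' : ℝ} {ρ : Matrix (A × B) (A × B) ℂ}
    (h : HasPurification β γ ρ) (hβ : β ≤ β') (hγ : γ ≤ γ') : HasPurification β' γ' ρ := by
  obtain ⟨J, J', _, _, _, _, Z, h1, h2, h3, h4⟩ := h
  exact ⟨J, J', inferInstance, inferInstance, inferInstance, inferInstance,
    Z, h1, h2.trans hβ,
    fun T => (h3 T).trans (mul_le_mul_of_nonneg_right hγ (norm_nonneg _)), h4⟩

theorem HasPurification.onLeft {β γ : ℝ} (hγ : 0 ≤ γ) {ρ : Matrix (A × B) (A × B) ℂ}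
    (h : HasPurification β γ ρ) (E : Channel A A') : HasPurification β γ (E.onLeft ρ) := by
  obtain ⟨J, J', _, _, _, _, Z, h1, h2, h3, h4⟩ := h
  have hV := E.conjTranspose_isometry_mul_self J
  have hV1 := l2_opNorm_le_one_of_isometry hV
  refine ⟨Fin E.num × J, J', inferInstance, inferInstance, inferInstance, inferInstance,
    E.isometry J * Z, ?_, (l2_opNorm_mul_le_right hV1 Z).trans h2, h3.mul_left hγ hV1, ?_⟩
  · simp only [Channel.onLeft, h1, Matrix.mul_sum, Matrix.sum_mul, mul_pureDensity_mul]
    rw [Fintype.sum_prod_type]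
    refine Finset.sum_congr rfl fun k _ => Finset.sum_congr rfl fun x _ =>
      Finset.sum_congr rfl fun y _ => congrArg _ ?_
    ext ⟨a, b⟩
    simp [branch, mulVec, dotProduct, mul_apply, Channel.isometry, Fintype.sum_prod_type,
      one_apply]
  · rw [conjTranspose_mul, trace_mul_comm, Matrix.mul_assoc, ← Matrix.mul_assoc _ _ Z, hV,
      Matrix.one_mul, trace_mul_comm, h4]

theorem HasPurification.onRight {β γ : ℝ} (hγ : 0 ≤ γ) {ρ : Matrix (A × B) (A × B) ℂ}
    (h : HasPurification β γ ρ) (F : Channel B B') : HasPurification β γ (F.onRight ρ) := by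
  obtain ⟨J, J', _, _, _, _, Z, h1, h2, h3, h4⟩ := h
  have hV : (F.isometry J')ᵀ * (F.isometry J')ᵀᴴ = 1 := by
    have h := congrArg transpose (F.conjTranspose_isometry_mul_self J')
    rw [transpose_mul, transpose_one] at h
    exact h
  have hV1 := l2_opNorm_le_one_of_coisometry hV
  refine ⟨J, Fin F.num × J', inferInstance, inferInstance, inferInstance, inferInstance,
    Z * (F.isometry J')ᵀ, ?_, (l2_opNorm_mul_le_left hV1 Z).trans h2, h3.mul_right hγ hV1, ?_⟩
  · simp only [Channel.onRight, h1, Matrix.mul_sum, Matrix.sum_mul, mul_pureDensity_mul]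
    rw [Finset.sum_comm]
    refine Finset.sum_congr rfl fun x _ => ?_
    rw [Fintype.sum_prod_type]
    refine Finset.sum_congr rfl fun k _ => Finset.sum_congr rfl fun y _ => congrArg _ ?_
    ext ⟨a, b⟩
    simp [branch, mulVec, dotProduct, mul_apply, Channel.isometry, Fintype.sum_prod_type,
      one_apply, mul_comm]
  · rw [conjTranspose_mul, Matrix.mul_assoc, ← Matrix.mul_assoc _ _ Zᴴ, hV, Matrix.one_mul, h4]

theorem submatrix_pureDensity {S T : Type} (v : S → ℂ) (e : T → S) :
    (pureDensity v).submatrix e e = pureDensity (v ∘ e) := rfl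

theorem submatrix_sum {ι S T : Type} (s : Finset ι) (f : ι → Matrix S S ℂ) (e : T → S) :
    (∑ i ∈ s, f i).submatrix e e = ∑ i ∈ s, (f i).submatrix e e := by
  ext i j
  simp [Matrix.sum_apply]

theorem HasPurification.moveRight {D : Type} [Fintype D] [DecidableEq D] {β γ : ℝ} (hγ : 0 ≤ γ)
    {ρ : Matrix ((A × D) × B) ((A × D) × B) ℂ} (h : HasPurification β γ ρ) :
    HasPurification (√(Fintype.card D) * β) (√(Fintype.card D) * γ)
      (ρ.submatrix (Equiv.prodAssoc A D B).symm (Equiv.prodAssoc A D B).symm) := by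
  obtain ⟨J, J', _, _, _, _, Z, h1, h2, h3, h4⟩ := h
  refine ⟨J, J', inferInstance, inferInstance, inferInstance, inferInstance,
    _root_.moveRight Z, ?_, (norm_moveRight_le Z).trans ?_,
    h3.moveRight hγ, (trace_moveRight_mul Z Z).trans h4⟩
  · simp only [h1, submatrix_sum, submatrix_pureDensity]
    rfl
  · gcongr

theorem HasPurification.moveLeft {D : Type} [Fintype D] [DecidableEq D] {β γ : ℝ} (hγ : 0 ≤ γ)
    {ρ : Matrix (A × (D × B)) (A × (D × B)) ℂ} (h : HasPurification β γ ρ) :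
    HasPurification (√(Fintype.card D) * β) (√(Fintype.card D) * γ)
      (ρ.submatrix (Equiv.prodAssoc A D B) (Equiv.prodAssoc A D B)) := by
  obtain ⟨J, J', _, _, _, _, Z, h1, h2, h3, h4⟩ := h
  refine ⟨J, J', inferInstance, inferInstance, inferInstance, inferInstance,
    _root_.moveLeft Z, ?_, (norm_moveLeft_le Z).trans ?_,
    h3.moveLeft hγ, (trace_moveRight_mul (_root_.moveLeft Z) (_root_.moveLeft Z)).symm.trans h4⟩
  · simp only [h1, submatrix_sum, submatrix_pureDensity]
    rfl
  · gcongr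

theorem sqrt_natCast_le_rpow_logb (d : ℕ) : √(d : ℝ) ≤ 2 ^ (Real.logb 2 d / 2) := by
  -- For `d = 0` the junk value `logb 2 0 = 0` makes the right-hand side `1`.
  rcases Nat.eq_zero_or_pos d with rfl | hd
  · simp
  · have hd' : (0 : ℝ) < d := Nat.cast_pos.2 hd
    rw [div_eq_mul_one_div, Real.rpow_mul two_pos.le, Real.rpow_logb two_pos (by norm_num) hd',
      Real.sqrt_eq_rpow]

theorem sqrt_card_mul_le {d : ℕ} {c δ : ℝ} (hδ : 0 ≤ δ) :
    2 ^ (c / 2) * (√(Fintype.card (Fin d)) * δ) ≤ 2 ^ ((Real.logb 2 d + c) / 2) * δ := by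
  rw [Fintype.card_fin, add_div, Real.rpow_add two_pos, ← mul_assoc, mul_comm (_ ^ (c / 2))]
  gcongr
  exact sqrt_natCast_le_rpow_logb d

/-- A protocol of cost `C` increases the operator norm and the trace norm of the coefficient matrix
by at most a factor `2 ^ (C / 2)` each. -/
theorem HasPurification.run (P : Protocol A' B' A B) : ∀ {β γ : ℝ}, 0 ≤ β → 0 ≤ γ →
    ∀ {ρ : Matrix (A × B) (A × B) ℂ}, HasPurification β γ ρ →
      HasPurification (2 ^ (P.cost / 2) * β) (2 ^ (P.cost / 2) * γ) (P.run ρ) := by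
  induction P with
  | finish E F =>
    intro β γ hβ hγ ρ h
    simpa [Protocol.cost, Protocol.run] using (h.onLeft hγ E).onRight hγ F
  | aliceSends d E rest ih =>
    intro β γ hβ hγ ρ h
    rw [Protocol.run, Protocol.cost]
    exact (ih (by positivity) (by positivity) ((h.onLeft hγ E).moveRight hγ)).mono
      (sqrt_card_mul_le hβ) (sqrt_card_mul_le hγ)
  | bobSends d F rest ih =>
    intro β γ hβ hγ ρ h
    rw [Protocol.run, Protocol.cost]
    exact (ih (by positivity) (by positivity) ((h.onRight hγ F).moveLeft hγ)).mono
      (sqrt_card_mul_le hβ) (sqrt_card_mul_le hγ)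

end Purification

/-! ### Overlaps bounded by matrix norms -/

section SpectrumSpread

open Matrix
open scoped Matrix.Norms.L2Operator

theorem mul_conjTranspose_apply_self {R C : Type*} [Fintype C] (T : Matrix R C ℂ) (r : R) :
    (T * Tᴴ) r r = ((∑ c, ‖T r c‖ ^ 2 : ℝ) : ℂ) := by
  simp [mul_apply, Complex.mul_conj, Complex.normSq_eq_norm_sq]

theorem trace_mul_conjTranspose_self {R C : Type*} [Fintype R] [Fintype C] (T : Matrix R C ℂ) :
    (T * Tᴴ).trace = ((∑ r, ∑ c, ‖T r c‖ ^ 2 : ℝ) : ℂ) := by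
  simp [trace, mul_conjTranspose_apply_self]

theorem row_norm_sq {R C : Type*} [DecidableEq R] [Fintype C] {T : Matrix R C ℂ} {w : R → ℝ}
    (hT : T * Tᴴ = diagonal fun r => (w r : ℂ)) (r : R) :
    ∑ c, ‖T r c‖ ^ 2 = w r := by
  have h := mul_conjTranspose_apply_self T r
  rw [hT, diagonal_apply_eq] at h
  exact_mod_cast h.symm

variable {R C : Type*} [Fintype R] [Fintype C] [DecidableEq R]
  {T W : Matrix R C ℂ} {w : R → ℝ}

/-- The part of the overlap of `W` with `T` that comes from the rows in `S` is bounded below if `W`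
is close to `T` in Frobenius norm. -/
theorem sub_sqrt_le_norm_overlap (hT : T * Tᴴ = diagonal fun r => (w r : ℂ)) {ε : ℝ}
    (hW : ∑ r, ∑ c, ‖(W - T) r c‖ ^ 2 ≤ ε) (S : Finset R) :
    ∑ r ∈ S, w r - √ε * √(∑ r ∈ S, w r) ≤ ‖∑ r ∈ S, (W * Tᴴ) r r‖ := by
  have h1 : ∑ r ∈ S, (W * Tᴴ) r r =
      ((∑ r ∈ S, w r : ℝ) : ℂ) + ∑ r ∈ S, ((W - T) * Tᴴ) r r := by
    push_cast
    rw [← Finset.sum_add_distrib]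
    refine Finset.sum_congr rfl fun r _ => ?_
    rw [Matrix.sub_mul, hT]
    simp
  have hw (r : R) : 0 ≤ w r := by
    rw [← row_norm_sq hT r]; positivity
  have h2 : ‖∑ r ∈ S, ((W - T) * Tᴴ) r r‖ ≤ √ε * √(∑ r ∈ S, w r) := by
    calc ‖∑ r ∈ S, ((W - T) * Tᴴ) r r‖
        ≤ ∑ r ∈ S, ∑ c, ‖(W - T) r c‖ * ‖T r c‖ := by
          refine (norm_sum_le _ _).trans (Finset.sum_le_sum fun r _ => ?_)
          rw [mul_apply]
          refine (norm_sum_le _ _).trans (Finset.sum_le_sum fun c _ => ?_)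
          rw [norm_mul, conjTranspose_apply, norm_star]
      _ = ∑ x ∈ S ×ˢ Finset.univ, ‖(W - T) x.1 x.2‖ * ‖T x.1 x.2‖ := by
          rw [Finset.sum_product]
      _ ≤ √(∑ x ∈ S ×ˢ Finset.univ, ‖(W - T) x.1 x.2‖ ^ 2) *
            √(∑ x ∈ S ×ˢ Finset.univ, ‖T x.1 x.2‖ ^ 2) := Real.sum_mul_le_sqrt_mul_sqrt _ _ _
      _ ≤ √ε * √(∑ r ∈ S, w r) := by
          rw [Finset.sum_product, Finset.sum_product]
          simp only [row_norm_sq hT]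
          gcongr
          refine le_trans (Finset.sum_le_sum_of_subset_of_nonneg (Finset.subset_univ S) ?_) hW
          intros; positivity
  rw [h1]
  have h3 := norm_sub_norm_le ((∑ r ∈ S, w r : ℝ) : ℂ) (-∑ r ∈ S, ((W - T) * Tᴴ) r r)
  rw [sub_neg_eq_add, norm_neg, Complex.norm_real, Real.norm_of_nonneg
    (Finset.sum_nonneg fun r _ => hw r)] at h3
  linarith

theorem norm_overlap_le_of_l2_opNorm_le [DecidableEq C]
    (hT : T * Tᴴ = diagonal fun r => (w r : ℂ)) {β : ℝ}
    (hW : ‖W‖ ≤ β) (S : Finset R) :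
    ‖∑ r ∈ S, (W * Tᴴ) r r‖ ≤ β * ∑ r ∈ S, √(w r) := by
  rw [Finset.mul_sum]
  refine (norm_sum_le _ _).trans (Finset.sum_le_sum fun r _ => ?_)
  rw [mul_apply]
  refine (norm_row_mul_le W r fun c => Tᴴ c r).trans ?_
  simp only [conjTranspose_apply, norm_star, row_norm_sq hT]
  gcongr

/-- Restricting `T` to the rows in `S` gives a test matrix of operator norm at most `√t`. -/
theorem norm_overlap_le_of_traceNormLE [DecidableEq C]
    (hT : T * Tᴴ = diagonal fun r => (w r : ℂ)) {γ : ℝ}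
    (hγ : 0 ≤ γ) (hW : TraceNormLE γ W) {S : Finset R} {t : ℝ} (ht : 0 ≤ t)
    (hS : ∀ r ∈ S, w r ≤ t) :
    ‖∑ r ∈ S, (W * Tᴴ) r r‖ ≤ γ * √t := by
  have hw (r : R) : 0 ≤ w r := by
    rw [← row_norm_sq hT r]; positivity
  let X : Matrix R C ℂ := diagonal (fun r => if r ∈ S then (1 : ℂ) else 0) * T
  have hX : X * Xᴴ = diagonal fun r => if r ∈ S then (w r : ℂ) else 0 := by
    rw [show X * Xᴴ = diagonal (fun r => if r ∈ S then (1 : ℂ) else 0) * (T * Tᴴ) *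
      (diagonal fun r => if r ∈ S then (1 : ℂ) else 0)ᴴ by
        simp only [X, conjTranspose_mul, Matrix.mul_assoc], hT, diagonal_conjTranspose,
      diagonal_mul_diagonal, diagonal_mul_diagonal]
    congr 1
    ext r
    by_cases hr : r ∈ S <;> simp [hr]
  have hXn : ‖X‖ ≤ √t := by
    refine Real.le_sqrt_of_sq_le ?_
    rw [← l2_opNorm_mul_conjTranspose_self, hX, l2_opNorm_diagonal, pi_norm_le_iff_of_nonneg ht]
    intro r
    by_cases hr : r ∈ S
    · simpa [hr, abs_of_nonneg (hw r)] using hS r hr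
    · simpa [hr] using ht
  have htr : (W * Xᴴ).trace = ∑ r ∈ S, (W * Tᴴ) r r := by
    simp only [X, conjTranspose_mul, ← Matrix.mul_assoc, trace, diag_apply, diagonal_conjTranspose,
      mul_diagonal]
    simp [apply_ite]
  rw [← htr]
  exact (hW X).trans (mul_le_mul_of_nonneg_left hXn hγ)

end SpectrumSpread

/-! ### States close to a product with widely spread spectrum -/

section SpreadBound

open Matrix
open scoped Matrix.Norms.L2Operator

variable {I C J C' : Type*} [Fintype I] [Fintype C] [Fintype J] [Fintype C']

/-- The partial overlap `⟨G|W⟩`: the vector (as a matrix) that remains of `W` when the factors `I`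
and `C` are projected on `G`. -/
def partialOverlap (G : Matrix I C ℂ) (W : Matrix (J × I) (C' × C) ℂ) : Matrix J C' ℂ :=
  Matrix.of fun j c' => ∑ i, ∑ c, star (G i c) * W (j, i) (c', c)

theorem trace_mul_kronecker_conjTranspose (G : Matrix I C ℂ) (H : Matrix J C' ℂ)
    (W : Matrix (J × I) (C' × C) ℂ) :
    (W * (H ⊗ₖ G)ᴴ).trace = (partialOverlap G W * Hᴴ).trace := by
  simp only [trace, diag_apply, mul_apply, conjTranspose_apply, kroneckerMap_apply, partialOverlap,
    of_apply, Fintype.sum_prod_type, Finset.sum_mul, star_mul']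
  refine Finset.sum_congr rfl fun j _ => ?_
  rw [Finset.sum_comm]
  refine Finset.sum_congr rfl fun c' _ => Finset.sum_congr rfl fun i _ =>
    Finset.sum_congr rfl fun c _ => ?_
  ring

/-- A unit vector `W` close to `H ⊗ G` has large spectral spread if `G` has: the product of its
operator norm and its trace norm is at least of order `√(b / a)` when both the part of the squared
singular values `p` of `G` that lies above `b` and the part that lies below `a` have mass at least
`1/20`. -/
theorem spread_bound [DecidableEq I] [DecidableEq C] [DecidableEq J] [DecidableEq C']
    {G : Matrix I C ℂ} {p : I → ℝ} (hG : G * Gᴴ = diagonal fun i => (p i : ℂ))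
    (hp : ∑ i, p i = 1) {W : Matrix (J × I) (C' × C) ℂ} {q : J → ℝ}
    (hH : partialOverlap G W * (partialOverlap G W)ᴴ = diagonal fun j => (q j : ℂ))
    {β γ a b ε : ℝ} (hβ : 0 < β) (hγ : 0 ≤ γ) (hWβ : ‖W‖ ≤ β) (hWγ : TraceNormLE γ W)
    (hW1 : (W * Wᴴ).trace = 1) (hε : ε ≤ 1 / 320) (hq : 1 - ε ≤ ∑ j, q j)
    (ha : 0 < a) (hb : 0 < b)
    (hlow : 1 / 20 ≤ ∑ i with p i ≤ a, p i) (hhigh : 1 / 20 ≤ ∑ i with b ≤ p i, p i) :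
    1 / 160 ≤ β * γ * √(a / b) := by
  set H := partialOverlap G W with hHdef
  have hp0 (i : I) : 0 ≤ p i := by rw [← row_norm_sq hG i]; positivity
  have hq0 (j : J) : 0 ≤ q j := by rw [← row_norm_sq hH j]; positivity
  let T : Matrix (J × I) (C' × C) ℂ := H ⊗ₖ G
  let w : J × I → ℝ := fun r => q r.1 * p r.2
  have hT : T * Tᴴ = diagonal fun r => (w r : ℂ) := by
    simp only [T, w, conjTranspose_kronecker, ← mul_kronecker_mul, hH, hG,
      diagonal_kronecker_diagonal, Complex.ofReal_mul]
  have htrT : (T * Tᴴ).trace = ((∑ j, q j : ℝ) : ℂ) := by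
    rw [hT, trace_diagonal, ← Complex.ofReal_sum, Fintype.sum_prod_type]
    simp only [w, ← Finset.mul_sum, hp, mul_one]
  have htrW : (W * Tᴴ).trace = ((∑ j, q j : ℝ) : ℂ) := by
    rw [trace_mul_kronecker_conjTranspose, ← hHdef, hH, trace_diagonal, ← Complex.ofReal_sum]
  have hdist : ∑ r, ∑ c, ‖(W - T) r c‖ ^ 2 ≤ ε := by
    have h := trace_mul_conjTranspose_self (W - T)
    have h2 : (T * Wᴴ).trace = ((∑ j, q j : ℝ) : ℂ) := by
      have := trace_conjTranspose (W * Tᴴ)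
      rw [conjTranspose_mul, conjTranspose_conjTranspose, htrW] at this
      simpa using this
    rw [conjTranspose_sub, Matrix.sub_mul, Matrix.mul_sub, Matrix.mul_sub, trace_sub, trace_sub,
      trace_sub, hW1, htrW, h2, htrT] at h
    have h' : (1 : ℝ) - ∑ j, q j - (∑ j, q j - ∑ j, q j) = ∑ r, ∑ c, ‖(W - T) r c‖ ^ 2 := by
      exact_mod_cast h
    linarith
  have hmass (P : J → Prop) (Q : I → Prop) [DecidablePred P] [DecidablePred Q] :
      ∑ r ∈ (Finset.univ.filter P) ×ˢ (Finset.univ.filter Q), w r =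
        (∑ j with P j, q j) * ∑ i with Q i, p i := by
    rw [Finset.sum_product, Finset.sum_mul_sum]
  -- The threshold is chosen so that the operator norm bound captures at most half of the overlap.
  let τ : ℝ := 4 * β ^ 2 / b
  have hτb : τ * b = (2 * β) ^ 2 := by simp only [τ]; field_simp; ring
  have hε0 : 0 ≤ ε := le_trans (by positivity) hdist
  -- The junk has little mass on Schmidt coefficients above the threshold.
  have hbig : ∑ j with τ < q j, q j ≤ 1 / 4 := by
    have h1 := sub_sqrt_le_norm_overlap hT hdist
      ((Finset.univ.filter fun j => τ < q j) ×ˢ (Finset.univ.filter fun i => b ≤ p i))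
    have h2 := norm_overlap_le_of_l2_opNorm_le hT hWβ
      ((Finset.univ.filter fun j => τ < q j) ×ˢ (Finset.univ.filter fun i => b ≤ p i))
    have h3 : β * ∑ r ∈ (Finset.univ.filter fun j => τ < q j) ×ˢ
        (Finset.univ.filter fun i => b ≤ p i), √(w r) ≤
        (∑ r ∈ (Finset.univ.filter fun j => τ < q j) ×ˢ
        (Finset.univ.filter fun i => b ≤ p i), w r) / 2 := by
      rw [Finset.mul_sum, Finset.sum_div]
      refine Finset.sum_le_sum fun r hr => ?_
      simp only [Finset.mem_product, Finset.mem_filter, Finset.mem_univ, true_and] at hr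
      have hw : (2 * β) ^ 2 ≤ w r := by
        rw [← hτb]
        exact mul_le_mul hr.1.le hr.2 hb.le (hq0 _)
      have h4 : 2 * β ≤ √(w r) := Real.le_sqrt_of_sq_le hw
      have h5 : √(w r) * √(w r) = w r := Real.mul_self_sqrt (by positivity [hq0 r.1, hp0 r.2])
      nlinarith [Real.sqrt_nonneg (w r)]
    rw [hmass] at h1 h3
    set h := ∑ j with τ < q j, q j with hdef
    set m := ∑ i with b ≤ p i, p i
    have hh : 0 ≤ h := Finset.sum_nonneg fun j _ => hq0 j
    have hμ : 0 ≤ h * m := mul_nonneg hh (by linarith)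
    have h6 : h * m / 2 ≤ √ε * √(h * m) := by linarith
    have h7 : √(h * m) ≤ 2 * √ε := by
      by_contra hc
      push Not at hc
      have : √(h * m) * √(h * m) = h * m := Real.mul_self_sqrt hμ
      nlinarith [Real.sqrt_nonneg ε]
    have h8 : h * m ≤ 4 * ε := by
      have e1 : √(h * m) * √(h * m) = h * m := Real.mul_self_sqrt hμ
      have e2 : √ε * √ε = ε := Real.mul_self_sqrt hε0
      nlinarith [Real.sqrt_nonneg ε, Real.sqrt_nonneg (h * m)]
    nlinarith
  have hsmall : 1 / 2 ≤ ∑ j with q j ≤ τ, q j := by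
    have h := Finset.sum_filter_add_sum_filter_not Finset.univ (fun j => τ < q j) q
    simp only [not_lt] at h
    linarith
  -- The rest of the junk, together with the small `p i`, forces a large trace norm.
  have h1 := sub_sqrt_le_norm_overlap hT hdist
    ((Finset.univ.filter fun j => q j ≤ τ) ×ˢ (Finset.univ.filter fun i => p i ≤ a))
  have h2 := norm_overlap_le_of_traceNormLE hT hγ hWγ (t := τ * a) (by positivity)
    (S := (Finset.univ.filter fun j => q j ≤ τ) ×ˢ (Finset.univ.filter fun i => p i ≤ a)) (by
      intro r hr
      simp only [Finset.mem_product, Finset.mem_filter, Finset.mem_univ, true_and] at hr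
      exact mul_le_mul hr.1 hr.2 (hp0 _) (by positivity))
  rw [hmass] at h1
  have hsq : √(τ * a) = 2 * β * √(a / b) := by
    rw [show τ * a = (2 * β) ^ 2 * (a / b) by simp only [τ]; ring, Real.sqrt_mul (sq_nonneg _),
      Real.sqrt_sq (by positivity)]
  rw [hsq] at h2
  set h := ∑ j with q j ≤ τ, q j
  set m := ∑ i with p i ≤ a, p i
  have hμ : 1 / 40 ≤ h * m := by nlinarith
  have h3 : √ε * √(h * m) ≤ h * m / 2 := by
    rw [← Real.sqrt_mul hε0]
    refine Real.sqrt_le_iff.2 ⟨by linarith, by nlinarith⟩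
  nlinarith

end SpreadBound

/-! ### Fidelity with a pure state -/

section Fidelity

open Matrix
open scoped ComplexOrder

/-- The fidelity with a pure state `v` is the expectation value of `ω` in `v`. -/
theorem fidelity_pureDensity {S : Type} [Fintype S] [DecidableEq S] {v : S → ℂ}
    (hv : IsPureState v) {ω : Matrix S S ℂ} {c : ℝ} (hc : 0 ≤ c)
    (h : star v ⬝ᵥ ω *ᵥ v = c) : fidelity (pureDensity v) ω = c := by
  have hvv : star v ⬝ᵥ v = 1 := by
    have h2 : ((∑ s, ‖v s‖ ^ 2 : ℝ) : ℂ) = 1 := by rw [hv, Complex.ofReal_one]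
    rw [← h2]
    simp [dotProduct, Complex.conj_mul']
  have hpos : (0 : Matrix S S ℂ) ≤ pureDensity v :=
    nonneg_iff_posSemidef.2 (posSemidef_vecMulVec_self_star v)
  have hidem : pureDensity v * pureDensity v = pureDensity v := by
    rw [pureDensity, vecMulVec_mul_vecMulVec, hvv, one_smul]
  have hsand : pureDensity v * ω * pureDensity v = (c : ℂ) • pureDensity v := by
    rw [pureDensity, Matrix.mul_assoc, mul_vecMulVec, vecMulVec_mul_vecMulVec, h, vecMulVec_smul]
  have hsqrt : CFC.sqrt ((c : ℂ) • pureDensity v) = ((√c : ℝ) : ℂ) • pureDensity v := by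
    refine CFC.sqrt_unique ?_ (nonneg_iff_posSemidef.2 ?_)
    · rw [smul_mul_smul_comm, hidem, ← Complex.ofReal_mul, Real.mul_self_sqrt hc]
    · exact (posSemidef_vecMulVec_self_star v).smul (by exact_mod_cast Real.sqrt_nonneg c)
  have htr : (pureDensity v).trace = 1 := by
    rw [pureDensity, trace_vecMulVec, dotProduct_comm, hvv]
  rw [fidelity, CFC.sqrt_unique hidem hpos, hsand, hsqrt, trace_smul, htr, smul_eq_mul, mul_one,
    Complex.ofReal_re, Real.sq_sqrt hc]

variable {A B J J' : Type} [Fintype A] [DecidableEq A] [Fintype B] [DecidableEq B]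
  [Fintype J] [Fintype J']

theorem fidelity_branches {θ : A × B → ℂ} (hθ : IsPureState θ)
    (Z : Matrix (J × A) (J' × B) ℂ) :
    fidelity (pureDensity θ) (∑ x, ∑ y, pureDensity (branch Z x y)) =
      ∑ x, ∑ y, ‖partialOverlap (coeffMatrix θ) Z x y‖ ^ 2 := by
  refine fidelity_pureDensity hθ (by positivity) ?_
  have h (x : J) (y : J') : star θ ⬝ᵥ pureDensity (branch Z x y) *ᵥ θ =
      ((‖partialOverlap (coeffMatrix θ) Z x y‖ ^ 2 : ℝ) : ℂ) := by
    have h1 : star θ ⬝ᵥ branch Z x y = partialOverlap (coeffMatrix θ) Z x y := by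
      simp [dotProduct, branch, partialOverlap, coeffMatrix, Fintype.sum_prod_type]
    have h2 : star (branch Z x y) ⬝ᵥ θ = star (partialOverlap (coeffMatrix θ) Z x y) := by
      rw [← h1]
      exact star_dotProduct _ _
    rw [pureDensity, vecMulVec_mulVec, h2, dotProduct_smul, h1]
    simp [Complex.mul_conj']
  simp only [sum_mulVec, dotProduct_sum, h]
  push_cast
  rfl

end Fidelity

/-! ### Schmidt bases -/

section Rotation

open Matrix
open scoped Matrix.Norms.L2Operator

variable {I C J C' : Type*} [Fintype I] [Fintype C] [Fintype J] [Fintype C']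
  [DecidableEq I]

theorem partialOverlap_mul (U : Matrix I I ℂ) (hU : U * Uᴴ = 1) (V : Matrix J J ℂ)
    (M : Matrix I C ℂ) (Z : Matrix (J × I) (C' × C) ℂ) :
    partialOverlap (Uᴴ * M) ((Vᴴ ⊗ₖ Uᴴ) * Z) = Vᴴ * partialOverlap M Z := by
  refine Matrix.ext_iff_trace_mul_right.2 fun X => ?_
  obtain ⟨H, rfl⟩ : ∃ H : Matrix J C' ℂ, X = Hᴴ := ⟨Xᴴ, (conjTranspose_conjTranspose X).symm⟩
  rw [← trace_mul_kronecker_conjTranspose, Matrix.mul_assoc, trace_mul_comm, Matrix.mul_assoc,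
    ← conjTranspose_kronecker, ← conjTranspose_mul, ← mul_kronecker_mul, ← Matrix.mul_assoc, hU,
    Matrix.one_mul, trace_mul_kronecker_conjTranspose, conjTranspose_mul, ← Matrix.mul_assoc,
    trace_mul_comm, Matrix.mul_assoc]

/-- Diagonalizing `M * Mᴴ` by a unitary `U` makes the rows of `Uᴴ * M` orthogonal, with the
eigenvalues as their squared norms. -/
theorem eigenvectorUnitary_mul_gram (M : Matrix I C ℂ) (hM : (M * Mᴴ).IsHermitian) :
    ((hM.eigenvectorUnitary : Matrix I I ℂ)ᴴ * M) *
      ((hM.eigenvectorUnitary : Matrix I I ℂ)ᴴ * M)ᴴ =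
      diagonal fun i => (hM.eigenvalues i : ℂ) := by
  have h := hM.spectral_theorem
  rw [Unitary.conjStarAlgAut_apply] at h
  have hU : (hM.eigenvectorUnitary : Matrix I I ℂ)ᴴ * (hM.eigenvectorUnitary : Matrix I I ℂ) = 1 :=
    Unitary.coe_star_mul_self hM.eigenvectorUnitary
  set U := (hM.eigenvectorUnitary : Matrix I I ℂ)
  calc (Uᴴ * M) * (Uᴴ * M)ᴴ = Uᴴ * (M * Mᴴ) * U := by
        rw [conjTranspose_mul, conjTranspose_conjTranspose]
        simp only [Matrix.mul_assoc]
    _ = Uᴴ * (U * diagonal (RCLike.ofReal ∘ hM.eigenvalues) * star U) * U :=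
        congrArg (fun X => Uᴴ * X * U) h
    _ = (Uᴴ * U) * diagonal (RCLike.ofReal ∘ hM.eigenvalues) * (Uᴴ * U) := by
        rw [star_eq_conjTranspose]
        simp only [Matrix.mul_assoc]
    _ = diagonal fun i => (hM.eigenvalues i : ℂ) := by
        rw [hU, Matrix.one_mul, Matrix.mul_one]
        rfl

/-- The spread bound for a coefficient matrix `M` whose Gram matrix is diagonalized by `U`. -/
theorem spread_bound_of_unitary [DecidableEq C] [DecidableEq J] [DecidableEq C']
    {M : Matrix I C ℂ} {U : Matrix I I ℂ} (hU : U * Uᴴ = 1)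
    {p : I → ℝ} (hM : (Uᴴ * M) * (Uᴴ * M)ᴴ = diagonal fun i => (p i : ℂ)) (hp : ∑ i, p i = 1)
    {Z : Matrix (J × I) (C' × C) ℂ} {β γ a b ε : ℝ} (hβ : 0 < β) (hγ : 0 ≤ γ) (hZβ : ‖Z‖ ≤ β)
    (hZγ : TraceNormLE γ Z) (hZ1 : (Z * Zᴴ).trace = 1) (hε : ε ≤ 1 / 320)
    (hF : 1 - ε ≤ ∑ x, ∑ y, ‖partialOverlap M Z x y‖ ^ 2) (ha : 0 < a) (hb : 0 < b)
    (hlow : 1 / 20 ≤ ∑ i with p i ≤ a, p i) (hhigh : 1 / 20 ≤ ∑ i with b ≤ p i, p i) :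
    1 / 160 ≤ β * γ * √(a / b) := by
  have hX := isHermitian_mul_conjTranspose_self (partialOverlap M Z)
  set V := (hX.eigenvectorUnitary : Matrix J J ℂ) with hVdef
  have hV : V * Vᴴ = 1 := Unitary.coe_mul_star_self hX.eigenvectorUnitary
  have hK : (Vᴴ ⊗ₖ Uᴴ)ᴴ * (Vᴴ ⊗ₖ Uᴴ) = 1 := by
    rw [conjTranspose_kronecker, ← mul_kronecker_mul, conjTranspose_conjTranspose,
      conjTranspose_conjTranspose, hV, hU, one_kronecker_one]
  have hK1 := l2_opNorm_le_one_of_isometry hK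
  have hH := eigenvectorUnitary_mul_gram (partialOverlap M Z) hX
  have hq : ∑ x, ∑ y, ‖partialOverlap M Z x y‖ ^ 2 = ∑ j, hX.eigenvalues j := by
    have h := trace_mul_conjTranspose_self (partialOverlap M Z)
    rw [hX.trace_eq_sum_eigenvalues] at h
    refine Complex.ofReal_injective (h.symm.trans ?_)
    rw [Complex.ofReal_sum]
    rfl
  rw [hq] at hF
  rw [← hVdef, ← partialOverlap_mul U hU V] at hH
  refine spread_bound hM hp hH hβ hγ ((l2_opNorm_mul_le_right hK1 Z).trans hZβ)
    (hZγ.mul_left hγ hK1) ?_ hε hF ha hb hlow hhigh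
  rw [conjTranspose_mul, trace_mul_comm, Matrix.mul_assoc, ← Matrix.mul_assoc _ _ Z, hK,
    Matrix.one_mul, trace_mul_comm, hZ1]

end Rotation

/-! ### Tensor powers -/

section TensorPower

open Matrix
open scoped Matrix.Norms.L2Operator

/-- The `n`-fold Kronecker power of a matrix, indexed by words of length `n`. -/
def kroneckerPow {A B : Type*} (M : Matrix A B ℂ) (n : ℕ) : Matrix (Fin n → A) (Fin n → B) ℂ :=
  Matrix.of fun I K => ∏ l, M (I l) (K l)

theorem kroneckerPow_mul {A B C : Type*} [Fintype B] [DecidableEq B] (M : Matrix A B ℂ)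
    (N : Matrix B C ℂ) (n : ℕ) :
    kroneckerPow (M * N) n = kroneckerPow M n * kroneckerPow N n := by
  ext I K
  simp only [kroneckerPow, of_apply, mul_apply, ← Finset.prod_mul_distrib]
  rw [Finset.prod_univ_sum, Fintype.piFinset_univ]

theorem kroneckerPow_conjTranspose {A B : Type*} (M : Matrix A B ℂ) (n : ℕ) :
    kroneckerPow Mᴴ n = (kroneckerPow M n)ᴴ := by
  ext I K
  simp [kroneckerPow]

theorem kroneckerPow_diagonal {A : Type*} [DecidableEq A] (v : A → ℂ) (n : ℕ) :
    kroneckerPow (diagonal v) n = diagonal fun I => ∏ l, v (I l) := by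
  ext I K
  by_cases h : I = K
  · subst h
    simp [kroneckerPow]
  · obtain ⟨l, hl⟩ := Function.ne_iff.1 h
    rw [diagonal_apply_ne _ h]
    exact Finset.prod_eq_zero (Finset.mem_univ l) (diagonal_apply_ne _ hl)

theorem kroneckerPow_one {A : Type*} [DecidableEq A] (n : ℕ) :
    kroneckerPow (1 : Matrix A A ℂ) n = 1 := by
  rw [← diagonal_one, kroneckerPow_diagonal, ← diagonal_one]
  simp

theorem coeffMatrix_tensorPow {A B : Type} (ψ : A × B → ℂ) (n : ℕ) :
    coeffMatrix (tensorPow ψ n) = kroneckerPow (coeffMatrix ψ) n := rfl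

theorem isPureState_tensorPow {A B : Type} [Fintype A] [Fintype B] {ψ : A × B → ℂ}
    (hψ : IsPureState ψ) (n : ℕ) : IsPureState (tensorPow ψ n) := by
  classical
  rw [IsPureState, ← (Equiv.arrowProdEquivProdArrow (Fin n) (fun _ => A) (fun _ => B)).sum_comp]
  simp only [tensorPow, Equiv.arrowProdEquivProdArrow, Equiv.coe_fn_mk, norm_prod,
    ← Finset.prod_pow]
  have h := Finset.prod_univ_sum (fun _ : Fin n => (Finset.univ : Finset (A × B)))
    (fun _ s => ‖ψ s‖ ^ 2)
  rw [IsPureState] at hψ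
  simpa [hψ] using h.symm

theorem sum_schmidtCoeff {A B : Type} [Fintype A] [DecidableEq A] [Fintype B] {ψ : A × B → ℂ}
    (hψ : IsPureState ψ) : ∑ a, schmidtCoeff ψ a = 1 := by
  classical
  have h := trace_mul_conjTranspose_self (coeffMatrix ψ)
  rw [show (coeffMatrix ψ * (coeffMatrix ψ)ᴴ).trace = (reducedState ψ).trace from rfl,
    (reducedState_isHermitian ψ).trace_eq_sum_eigenvalues] at h
  rw [IsPureState, Fintype.sum_prod_type] at hψ
  rw [← hψ]
  refine Complex.ofReal_injective (Eq.trans ?_ h)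
  rw [Complex.ofReal_sum]
  rfl

theorem exists_unitary_schmidt {A B : Type} [Fintype A] [DecidableEq A] [Fintype B]
    (ψ : A × B → ℂ) : ∃ U : Matrix A A ℂ, U * Uᴴ = 1 ∧
      (Uᴴ * coeffMatrix ψ) * (Uᴴ * coeffMatrix ψ)ᴴ =
        diagonal fun a => (schmidtCoeff ψ a : ℂ) :=
  ⟨_, Unitary.coe_mul_star_self (reducedState_isHermitian ψ).eigenvectorUnitary,
    eigenvectorUnitary_mul_gram (coeffMatrix ψ) (reducedState_isHermitian ψ)⟩

theorem schmidtCoeff_nonneg {A B : Type} [Fintype A] [DecidableEq A] [Fintype B]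
    (ψ : A × B → ℂ) (a : A) : 0 ≤ schmidtCoeff ψ a := by
  classical
  obtain ⟨U, _, hU⟩ := exists_unitary_schmidt ψ
  rw [← row_norm_sq hU a]
  positivity

/-- The coefficient matrix of `k` EPR pairs is a multiple of the identity. -/
theorem hasPurification_epr (k : ℕ) :
    HasPurification ((1 / √2) ^ k) (√2 ^ k) (pureDensity (tensorPow epr k)) := by
  have h2 : (0 : ℝ) < √2 := by positivity
  have hs : √2 * √2 = (2 : ℝ) := Real.mul_self_sqrt two_pos.le
  set c : ℝ := (1 / √2) ^ k with hc
  have hc0 : 0 ≤ c := by positivity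
  have hc2 : c * 2 ^ k = √2 ^ k := by
    rw [hc, ← mul_pow]
    congr 1
    rw [div_mul_eq_mul_div, one_mul, div_eq_iff h2.ne', hs]
  have hc1 : c * √2 ^ k = 1 := by
    rw [hc, ← mul_pow, one_div_mul_cancel h2.ne', one_pow]
  let Z : Matrix (Unit × (Fin k → Fin 2)) (Unit × (Fin k → Fin 2)) ℂ :=
    Matrix.of fun p q => tensorPow epr k (p.2, q.2)
  have hZ : Z = (c : ℂ) • (1 : Matrix (Unit × (Fin k → Fin 2)) (Unit × (Fin k → Fin 2)) ℂ) := by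
    have h1 : coeffMatrix epr = diagonal fun _ => ((1 / √2 : ℝ) : ℂ) := by
      ext a b
      simp [coeffMatrix, epr, diagonal_apply]
    ext ⟨_, x⟩ ⟨_, y⟩
    change coeffMatrix (tensorPow epr k) x y = _
    rw [coeffMatrix_tensorPow, h1, kroneckerPow_diagonal]
    simp [diagonal_apply, one_apply, hc]
  have hcard : Fintype.card (Unit × (Fin k → Fin 2)) = 2 ^ k := by simp
  refine ⟨Unit, Unit, inferInstance, inferInstance, inferInstance, inferInstance, Z, ?_, ?_, ?_, ?_⟩
  · simp only [Finset.univ_unique, Finset.sum_singleton]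
    rfl
  · rw [hZ, norm_smul, Complex.norm_real, Real.norm_of_nonneg hc0]
    exact mul_le_of_le_one_right hc0 l2_opNorm_one_le
  · intro T
    rw [hZ, smul_mul, Matrix.one_mul, trace_smul, norm_smul, Complex.norm_real,
      Real.norm_of_nonneg hc0, trace_conjTranspose, norm_star, ← hc2, mul_assoc]
    refine mul_le_mul_of_nonneg_left ((norm_sum_le _ _).trans ?_) hc0
    refine (Finset.sum_le_sum fun i _ => norm_apply_le_l2_opNorm T i i).trans (le_of_eq ?_)
    rw [Finset.sum_const, Finset.card_univ, hcard, nsmul_eq_mul]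
    push_cast
    rfl
  · rw [hZ, conjTranspose_smul, conjTranspose_one, smul_mul_smul_comm, Matrix.one_mul, trace_smul,
      trace_one, hcard]
    have : c * c * 2 ^ k = 1 := by rw [mul_assoc, hc2, hc1]
    simp only [Complex.star_def, Complex.conj_ofReal, smul_eq_mul]
    exact_mod_cast this

end TensorPower

/-! ### Spread of the Schmidt coefficients of a tensor power -/

section Concentration

variable {A : Type*} [Fintype A]

/-- The product of `n` copies of a probability vector whose nonzero entries are not all equal has
constant mass both on probabilities at least `b` and on probabilities at most `a`, where `b / a` is
exponentially large in `√n`. -/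
theorem exists_spread {p : A → ℝ} (hp0 : ∀ a, 0 ≤ p a) (hp : ∑ a, p a = 1)
    {i j : A} (hi : p i ≠ 0) (hj : p j ≠ 0) (hij : p i ≠ p j) :
    ∃ σ : ℝ, 0 < σ ∧ ∃ n₀ : ℕ, ∀ n ≥ n₀, ∃ a b : ℝ, 0 < a ∧ 0 < b ∧
      √(a / b) = Real.exp (-(σ * √n)) ∧
      1 / 20 ≤ ∑ I : Fin n → A with ∏ l, p (I l) ≤ a, ∏ l, p (I l) ∧
      1 / 20 ≤ ∑ I : Fin n → A with b ≤ ∏ l, p (I l), ∏ l, p (I l) := by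
  set E : ℝ := -∑ a, p a * Real.log (p a) with hE
  -- Entries `p a = 0` carry the junk value `log 0 = 0`, but have weight zero throughout.
  set x : A → ℝ := fun a => Real.log (p a) + E with hx
  have hx0 : ∑ a, p a * x a = 0 := by
    simp only [hx, mul_add, Finset.sum_add_distrib, ← Finset.sum_mul, hp, hE]
    ring
  set V := ∑ a, p a * x a ^ 2 with hV
  set μ := ∑ a, p a * x a ^ 4
  have hVnn (a : A) : 0 ≤ p a * x a ^ 2 := mul_nonneg (hp0 a) (sq_nonneg _)
  have hVpos : 0 < V := by
    refine lt_of_le_of_ne (Finset.sum_nonneg fun a _ => hVnn a) fun h => hij ?_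
    have h0 := (Finset.sum_eq_zero_iff_of_nonneg fun a _ => hVnn a).1 h.symm
    have h1 : x i = 0 := by simpa [hi] using h0 i (Finset.mem_univ i)
    have h2 : x j = 0 := by simpa [hj] using h0 j (Finset.mem_univ j)
    have h3 : Real.log (p i) = Real.log (p j) := by simp only [hx] at h1 h2; linarith
    exact Real.log_injOn_pos (lt_of_le_of_ne (hp0 i) hi.symm) (lt_of_le_of_ne (hp0 j) hj.symm) h3
  obtain ⟨n₁, hn₁⟩ := exists_nat_ge (μ / V ^ 2)
  refine ⟨√V / 8, by positivity, n₁ + 1, fun n hn => ?_⟩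
  have hn0 : (0 : ℝ) < n := Nat.cast_pos.2 (by omega)
  set s := √V * √n with hs
  have hspos : 0 < s := by positivity
  have hs2 : s ^ 2 = n * V := by
    rw [hs, mul_pow, Real.sq_sqrt hVpos.le, Real.sq_sqrt hn0.le, mul_comm]
  have hP0 (I : Fin n → A) : 0 ≤ ∏ l, p (I l) := Finset.prod_nonneg fun l _ => hp0 _
  obtain ⟨h1, h2, h4⟩ := iid_moments hp hx0 n
  have h4' : ∑ I : Fin n → A, (∏ l, p (I l)) * (∑ l, x (I l)) ^ 4 ≤ 4 * s ^ 4 := by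
    have hμ : μ ≤ n * V ^ 2 := by
      rw [← div_le_iff₀ (by positivity)]
      exact hn₁.trans (by exact_mod_cast (by omega : n₁ ≤ n))
    rw [h4, show s ^ 4 = (s ^ 2) ^ 2 by ring, hs2]
    nlinarith [mul_le_mul_of_nonneg_left hμ hn0.le, mul_nonneg hn0.le (sq_nonneg V)]
  have h2' := h2.trans hs2.symm
  have hexp (I : Fin n → A) (hI : ∏ l, p (I l) ≠ 0) :
      ∏ l, p (I l) = Real.exp (∑ l, x (I l) - n * E) := by
    have hne : ∀ l, p (I l) ≠ 0 := fun l => Finset.prod_ne_zero_iff.1 hI l (Finset.mem_univ l)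
    simp only [hx, Finset.sum_add_distrib, Finset.sum_const, Finset.card_univ, Fintype.card_fin,
      nsmul_eq_mul, add_sub_cancel_right]
    rw [Real.exp_sum]
    exact Finset.prod_congr rfl fun l _ =>
      (Real.exp_log (lt_of_le_of_ne (hp0 _) (hne l).symm)).symm
  have mono (P Q : (Fin n → A) → Prop) [DecidablePred P] [DecidablePred Q]
      (h : ∀ I, ∏ l, p (I l) ≠ 0 → P I → Q I) :
      ∑ I with P I, ∏ l, p (I l) ≤ ∑ I with Q I, ∏ l, p (I l) := by
    rw [Finset.sum_filter, Finset.sum_filter]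
    refine Finset.sum_le_sum fun I _ => ?_
    by_cases h0 : ∏ l, p (I l) = 0
    · simp [h0]
    · by_cases hP : P I
      · rw [if_pos hP, if_pos (h I h0 hP)]
      · rw [if_neg hP]
        split_ifs
        exacts [hP0 I, le_rfl]
  refine ⟨Real.exp (-(s / 8) - n * E), Real.exp (s / 8 - n * E), Real.exp_pos _, Real.exp_pos _,
    ?_, ?_, ?_⟩
  · rw [← Real.exp_sub, ← Real.exp_half, hs]
    congr 1
    ring
  · refine (upper_deviation (P := fun I : Fin n → A => ∏ l, p (I l))
      (X := fun I => -∑ l, x (I l)) hP0 (sum_prod_eq_one hp n) hspos ?_ ?_ ?_).trans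
      (mono (fun I => s / 8 ≤ -∑ l, x (I l)) _ fun I hI hX => ?_)
    · simp only [mul_neg, Finset.sum_neg_distrib, h1, neg_zero]
    · simpa only [neg_sq] using h2'
    · simpa only [Even.neg_pow (by decide : Even 4)] using h4'
    · rw [hexp I hI, Real.exp_le_exp]
      linarith
  · refine (upper_deviation (P := fun I : Fin n → A => ∏ l, p (I l))
      (X := fun I => ∑ l, x (I l)) hP0 (sum_prod_eq_one hp n) hspos h1 h2' h4').trans
      (mono (fun I => s / 8 ≤ ∑ l, x (I l)) _ fun I hI hX => ?_)
    rw [hexp I hI, Real.exp_le_exp]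
    linarith

end Concentration

/-! ### The cost of entanglement dilution -/

section DilutionCost

open Matrix
open scoped Matrix.Norms.L2Operator

/-- If the `n`-fold product of the Schmidt coefficients of `ψ` has mass at least `1/20` both below
`a` and above `b`, then creating `ψ ^ ⊗ n` from EPR pairs takes communication of about
`log₂ √(b / a)`. -/
theorem le_two_rpow_cost_mul {A B : Type} [Fintype A] [DecidableEq A] [Fintype B] [DecidableEq B]
    {ψ : A × B → ℂ} (hψ : IsPureState ψ) {ε : ℝ} (hε : ε ≤ 1 / 320) {n k : ℕ}
    (P : Protocol (Fin n → A) (Fin n → B) (Fin k → Fin 2) (Fin k → Fin 2))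
    (hP : 1 - ε ≤ fidelity (pureDensity (tensorPow ψ n))
      (P.run (pureDensity (tensorPow epr k)))) {a b : ℝ} (ha : 0 < a) (hb : 0 < b)
    (hlow : 1 / 20 ≤ ∑ I : Fin n → A with ∏ l, schmidtCoeff ψ (I l) ≤ a,
      ∏ l, schmidtCoeff ψ (I l))
    (hhigh : 1 / 20 ≤ ∑ I : Fin n → A with b ≤ ∏ l, schmidtCoeff ψ (I l),
      ∏ l, schmidtCoeff ψ (I l)) :
    1 / 160 ≤ 2 ^ P.cost * √(a / b) := by
  obtain ⟨J, J', _, _, _, _, Z, hZ, hZβ, hZγ, hZ1⟩ :=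
    (hasPurification_epr k).run P (by positivity) (by positivity)
  rw [hZ, fidelity_branches (isPureState_tensorPow hψ n), coeffMatrix_tensorPow] at hP
  obtain ⟨U, hU, hM⟩ := exists_unitary_schmidt ψ
  have hUn : kroneckerPow U n * (kroneckerPow U n)ᴴ = 1 := by
    rw [← kroneckerPow_conjTranspose, ← kroneckerPow_mul, hU, kroneckerPow_one]
  have hMn : ((kroneckerPow U n)ᴴ * kroneckerPow (coeffMatrix ψ) n) *
      ((kroneckerPow U n)ᴴ * kroneckerPow (coeffMatrix ψ) n)ᴴ =
      diagonal fun I => ((∏ l, schmidtCoeff ψ (I l) : ℝ) : ℂ) := by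
    rw [← kroneckerPow_conjTranspose U, ← kroneckerPow_mul, ← kroneckerPow_conjTranspose,
      ← kroneckerPow_mul, hM, kroneckerPow_diagonal]
    simp only [Complex.ofReal_prod]
  refine (spread_bound_of_unitary hUn hMn (sum_prod_eq_one (sum_schmidtCoeff hψ) n)
    (by positivity) (by positivity) hZβ hZγ hZ1 hε hP ha hb hlow hhigh).trans (le_of_eq ?_)
  have h1 : (2 : ℝ) ^ (P.cost / 2) * 2 ^ (P.cost / 2) = 2 ^ P.cost := by
    rw [← Real.rpow_add two_pos, add_halves]
  have h2 : (1 / √2) ^ k * √2 ^ k = (1 : ℝ) := by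
    rw [← mul_pow, one_div_mul_cancel (by positivity), one_pow]
  rw [show (2 : ℝ) ^ (P.cost / 2) * (1 / √2) ^ k * (2 ^ (P.cost / 2) * √2 ^ k) =
    2 ^ (P.cost / 2) * 2 ^ (P.cost / 2) * ((1 / √2) ^ k * √2 ^ k) by ring, h1, h2, mul_one]

end DilutionCost

theorem theorem3 :
    ∃ ε₀ : ℝ, 0 < ε₀ ∧
      ∀ (A B : Type) [Fintype A] [DecidableEq A] [Fintype B] [DecidableEq B] (ψ : A × B → ℂ),
        IsPureState ψ → ¬ IsSeparableState ψ → ¬ IsMaximallyEntangled ψ →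
        ∀ ε : ℝ, 0 ≤ ε → ε < ε₀ →
          ∃ D : ℝ, 0 < D ∧
            ∃ f : ℕ → ℝ, f =o[Filter.atTop] (fun n : ℕ => √(n : ℝ)) ∧
              ∀ (n k : ℕ)
                (P : Protocol (Fin n → A) (Fin n → B) (Fin k → Fin 2) (Fin k → Fin 2)),
                1 - ε ≤ fidelity (pureDensity (tensorPow ψ n))
                    (P.run (pureDensity (tensorPow epr k))) →
                D * √(n : ℝ) - f n ≤ P.cost := by
  refine ⟨1 / 320, by norm_num, fun A B _ _ _ _ ψ hψ _ hme ε _ hε => ?_⟩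
  simp only [IsMaximallyEntangled, not_forall] at hme
  obtain ⟨i, j, hi, hj, hij⟩ := hme
  obtain ⟨σ, hσ, n₀, hspread⟩ := exists_spread (schmidtCoeff_nonneg ψ)
    (sum_schmidtCoeff hψ) hi hj hij
  have hlog2 : 0 < Real.log 2 := Real.log_pos one_lt_two
  have hD : 0 < σ / Real.log 2 := by positivity
  have h160 : 0 < Real.log 160 := Real.log_pos (by norm_num)
  -- The constant term of `f` absorbs the finitely many small `n`, for which `0 ≤ C` suffices.
  refine ⟨σ / Real.log 2, hD,
    fun _ => Real.log 160 / Real.log 2 + σ / Real.log 2 * √(n₀ : ℝ), ?_, fun n k P hP => ?_⟩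
  · refine Asymptotics.isLittleO_const_left.2 (Or.inr ?_)
    exact tendsto_norm_atTop_atTop.comp
      (Real.tendsto_sqrt_atTop.comp tendsto_natCast_atTop_atTop)
  · rcases lt_or_ge n n₀ with hn | hn
    · have h : √(n : ℝ) ≤ √(n₀ : ℝ) := Real.sqrt_le_sqrt (by exact_mod_cast hn.le)
      have h1 := mul_le_mul_of_nonneg_left h hD.le
      have h2 : 0 < Real.log 160 / Real.log 2 := by positivity
      have := P.cost_nonneg
      linarith
    · obtain ⟨a, b, ha, hb, hab, hlow, hhigh⟩ := hspread n hn
      have h := le_two_rpow_cost_mul hψ hε.le P hP ha hb hlow hhigh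
      rw [hab, Real.rpow_def_of_pos two_pos, ← Real.exp_add] at h
      have h1 := Real.log_le_log (by norm_num) h
      rw [Real.log_exp, one_div, Real.log_inv] at h1
      have h2 : σ / Real.log 2 * √(n : ℝ) - Real.log 160 / Real.log 2 ≤ P.cost := by
        rw [div_mul_eq_mul_div, ← sub_div, div_le_iff₀ hlog2]
        linarith
      have h3 : 0 ≤ σ / Real.log 2 * √(n₀ : ℝ) := by positivity
      linarith
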